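/- Let $X\in\mathbb{R}^{n\times d}$, and let $B\in\mathbb{R}^{d\times d}$ be symmetric positive semidefinite with $X^\top X-B$ positive definite. For $Y\in\mathbb{R}^{n\times d}$ near $X$ put $$U(Y)=Y\,(Y^\top Y)^{-1/2}\,(Y^\top Y-B)^{1/2},$$ where $B$ is held fixed, $A^{1/2}$ denotes the positive semidefinite square root of a positive semidefinite matrix $A$, and $A^{-1/2}=(A^{1/2})^{-1}$. Let $J=\partial\,\mathrm{vec}\,U(Y)/\partial(\mathrm{vec}\,Y)^\top\big|_{Y=X}\in\mathbb{R}^{nd\times nd}$ be the Jacobian matrix of $U$ at $X$, where $\mathrm{vec}$ stacks the columns of a matrix. Then $U$ is differentiable at $X$, $\det J\neq 0$, and $$\frac{1}{|\det J|}\le\left(\frac{\det(X^\top X)}{\det(X^\top X-B)}\right)^{n/2}.$$ -/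

import Mathlib

open scoped Matrix

noncomputable section

open scoped MatrixOrder in
/-- The positive semidefinite square root `A^{1/2}` of a real positive semidefinite matrix `A`. -/
def psdSqrt {d : ℕ} (A : Matrix (Fin d) (Fin d) ℝ) : Matrix (Fin d) (Fin d) ℝ :=
  CFC.sqrt A

/-- The matrix `U(X) = X (Xᵀ X)^{-1/2} (Xᵀ X - B)^{1/2}`. -/
def alignedMatrix {n d : ℕ} (B : Matrix (Fin d) (Fin d) ℝ) (X : Matrix (Fin n) (Fin d) ℝ) :
    Matrix (Fin n) (Fin d) ℝ :=
  X * (psdSqrt (Xᵀ * X))⁻¹ * psdSqrt (Xᵀ * X - B)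

/-- The inverse of the column-stacking vectorization `Matrix.vec`. -/
def unvec {n d : ℕ} (v : Fin d × Fin n → ℝ) : Matrix (Fin n) (Fin d) ℝ :=
  Matrix.of fun i j => v (j, i)

/-- A matrix-valued function of a matrix, as a function `vec X ↦ vec (F X)` of vectors. -/
def vectorized {n d : ℕ} (F : Matrix (Fin n) (Fin d) ℝ → Matrix (Fin n) (Fin d) ℝ)
    (v : Fin d × Fin n → ℝ) : Fin d × Fin n → ℝ :=
  (F (unvec v)).vec

/-- The Jacobian matrix `∂ vec F(X) / ∂ (vec X)ᵀ`, of size `nd × nd`: the matrix, in the standard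
basis, of the Fréchet derivative of `vec X ↦ vec (F X)`. -/
def jacobianMatrix {n d : ℕ} (F : Matrix (Fin n) (Fin d) ℝ → Matrix (Fin n) (Fin d) ℝ)
    (X : Matrix (Fin n) (Fin d) ℝ) : Matrix (Fin d × Fin n) (Fin d × Fin n) ℝ :=
  LinearMap.toMatrix' (fderiv ℝ (vectorized F) X.vec).toLinearMap

end

open scoped Matrix

noncomputable section

/-! Write `X = H P` with `Hᵀ H = 1` and `P = (Xᵀ X)^{1/2}`. Then `U(X) = H Q` with `Q = (Xᵀ X -
B)^{1/2}`: the map keeps `H` and shifts the Gram matrix by a constant, so in polar coordinates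
(factor, Gram matrix) its derivative is the identity.

A single `n × d` matrix `K` encodes a tangent vector in these coordinates. With `M = Hᵀ K`, the Gram
matrix varies by `M + Mᵀ` and the factor by `K - ½ H (M + Mᵀ)`. Passing from `K` to the variation of
`H P` gives `polarTangent`, and the chain rule reads `dU ∘ polarTangent hP H = polarTangent hQ H`
(`alignedDeriv_comp_polarTangent`).

By `det_polarTangent`, `polarTangent hP H` has determinant `(det P)^(n-d-1)`. Hence `det J = (det Q
/ det P)^(n-d-1)`, which is positive. Since `det Q ≤ det P`, the inverse `(det P / det Q)^(n-d-1)`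
is at most `(det P / det Q)^n`, the claimed bound. -/

/-- Vectorization as a linear equivalence. -/
def vecEquiv (n d : ℕ) : Matrix (Fin n) (Fin d) ℝ ≃ₗ[ℝ] (Fin d × Fin n → ℝ) where
  toFun M := M.vec
  invFun := unvec
  map_add' _ _ := rfl
  map_smul' _ _ := rfl
  left_inv _ := rfl
  right_inv _ := rfl

@[simp] lemma vecEquiv_apply {n d : ℕ} (M : Matrix (Fin n) (Fin d) ℝ) :
    vecEquiv n d M = M.vec := rfl

@[simp] lemma vecEquiv_symm_apply {n d : ℕ} (v : Fin d × Fin n → ℝ) :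
    (vecEquiv n d).symm v = unvec v := rfl

lemma det_eq_of_vec_eq_mulVec {n d : ℕ}
    (f : Matrix (Fin n) (Fin d) ℝ →ₗ[ℝ] Matrix (Fin n) (Fin d) ℝ)
    (A : Matrix (Fin d × Fin n) (Fin d × Fin n) ℝ) (h : ∀ M, (f M).vec = A *ᵥ M.vec) :
    LinearMap.det f = A.det := by
  rw [← LinearMap.det_conj f (vecEquiv n d), ← LinearMap.det_toLin']
  congr 1
  ext1 v
  ext1
  simp only [LinearMap.comp_apply, LinearEquiv.coe_coe, vecEquiv_apply, vecEquiv_symm_apply, h,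
    Matrix.toLin'_apply]
  rfl

/-! ### Determinants of multiplication maps -/

/-- Right multiplication by `P` as a linear map. -/
def mulRightLin {n d : ℕ} (P : Matrix (Fin d) (Fin d) ℝ) :
    Matrix (Fin n) (Fin d) ℝ →ₗ[ℝ] Matrix (Fin n) (Fin d) ℝ where
  toFun M := M * P
  map_add' _ _ := Matrix.add_mul _ _ _
  map_smul' _ _ := Matrix.smul_mul _ _ _

/-- Left multiplication by `H` as a linear map. -/
def mulLeftLin {m n d : ℕ} (H : Matrix (Fin m) (Fin n) ℝ) :
    Matrix (Fin n) (Fin d) ℝ →ₗ[ℝ] Matrix (Fin m) (Fin d) ℝ where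
  toFun M := H * M
  map_add' _ _ := Matrix.mul_add _ _ _
  map_smul' _ _ := Matrix.mul_smul _ _ _

@[simp] lemma mulRightLin_apply {n d : ℕ} (P : Matrix (Fin d) (Fin d) ℝ)
    (M : Matrix (Fin n) (Fin d) ℝ) : mulRightLin P M = M * P := rfl

@[simp] lemma mulLeftLin_apply {m n d : ℕ} (H : Matrix (Fin m) (Fin n) ℝ)
    (M : Matrix (Fin n) (Fin d) ℝ) : mulLeftLin H M = H * M := rfl

lemma det_mulRightLin {n d : ℕ} (P : Matrix (Fin d) (Fin d) ℝ) :
    LinearMap.det (mulRightLin (n := n) P) = P.det ^ n := by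
  rw [det_eq_of_vec_eq_mulVec _ (Matrix.kroneckerMap (· * ·) Pᵀ (1 : Matrix (Fin n) (Fin n) ℝ)),
    Matrix.det_kronecker]
  · simp
  · intro M
    rw [Matrix.kronecker_mulVec_vec]
    simp

lemma det_mulLeftLin {n d : ℕ} (P : Matrix (Fin n) (Fin n) ℝ) :
    LinearMap.det (mulLeftLin (d := d) P) = P.det ^ d := by
  rw [det_eq_of_vec_eq_mulVec _ (Matrix.kroneckerMap (· * ·) (1 : Matrix (Fin d) (Fin d) ℝ) P),
    Matrix.det_kronecker]
  · simp
  · intro M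
    rw [Matrix.kronecker_mulVec_vec]
    simp

/-- The Weinstein–Aronszajn identity for linear maps. -/
lemma LinearMap.det_id_add_comp_comm {V W : Type*} [AddCommGroup V] [Module ℝ V]
    [Module.Finite ℝ V] [AddCommGroup W] [Module ℝ W] [Module.Finite ℝ W]
    (a : V →ₗ[ℝ] W) (b : W →ₗ[ℝ] V) :
    LinearMap.det (LinearMap.id + a ∘ₗ b) = LinearMap.det (LinearMap.id + b ∘ₗ a) := by
  classical
  let v := Module.finBasis ℝ V
  let w := Module.finBasis ℝ W
  rw [← LinearMap.det_toMatrix w, ← LinearMap.det_toMatrix v, map_add, map_add,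
    LinearMap.toMatrix_id, LinearMap.toMatrix_id, LinearMap.toMatrix_comp w v w,
    LinearMap.toMatrix_comp v w v, Matrix.det_one_add_mul_comm]

/-! ### Scaling the skew part of a matrix -/

/-- The map `M ↦ M + Mᵀ`. -/
def symmLin (d : ℕ) : Matrix (Fin d) (Fin d) ℝ →ₗ[ℝ] Matrix (Fin d) (Fin d) ℝ where
  toFun M := M + Mᵀ
  map_add' _ _ := by rw [Matrix.transpose_add]; abel
  map_smul' _ _ := by simp

@[simp] lemma symmLin_apply {d : ℕ} (M : Matrix (Fin d) (Fin d) ℝ) :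
    symmLin d M = M + Mᵀ := rfl

/-- The map `M ↦ P A P + S`, where `A` and `S` are the skew and symmetric parts of `M`. -/
def skewScale {d : ℕ} (P : Matrix (Fin d) (Fin d) ℝ) :
    Matrix (Fin d) (Fin d) ℝ →ₗ[ℝ] Matrix (Fin d) (Fin d) ℝ where
  toFun M := (1 / 2 : ℝ) • (P * (M - Mᵀ) * P) + (1 / 2 : ℝ) • (M + Mᵀ)
  map_add' M N := by
    simp only [Matrix.transpose_add, add_sub_add_comm, Matrix.mul_add, Matrix.add_mul, smul_add]
    abel
  map_smul' c M := by
    simp only [Matrix.transpose_smul, ← smul_sub, ← smul_add, Matrix.mul_smul, Matrix.smul_mul,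
      RingHom.id_apply]
    rw [smul_comm c]

lemma skewScale_apply {d : ℕ} (P M : Matrix (Fin d) (Fin d) ℝ) :
    skewScale P M = (1 / 2 : ℝ) • (P * (M - Mᵀ) * P) + (1 / 2 : ℝ) • (M + Mᵀ) := rfl

/-- Coordinates in which `skewScale` of a diagonal matrix is diagonal. -/
def symmSkewCoord (d : ℕ) : Matrix (Fin d) (Fin d) ℝ →ₗ[ℝ] Matrix (Fin d) (Fin d) ℝ where
  toFun M := Matrix.of fun i j => if i ≤ j then M i j + M j i else M i j - M j i
  map_add' M N := by
    ext i j
    by_cases h : i ≤ j <;> simp [h] <;> ring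
  map_smul' c M := by
    ext i j
    by_cases h : i ≤ j <;> simp [h] <;> ring

lemma det_symmSkewCoord_ne_zero (d : ℕ) : LinearMap.det (symmSkewCoord d) ≠ 0 := by
  intro h
  rw [LinearMap.det_eq_zero_iff_ker_ne_bot] at h
  refine h (LinearMap.ker_eq_bot'.2 fun M hM => ?_)
  have key : ∀ i j, (if i ≤ j then M i j + M j i else M i j - M j i) = 0 := fun i j =>
    congrFun (congrFun hM i) j
  ext i j
  have h1 := key i j
  have h2 := key j i
  rcases lt_trichotomy i j with hij | rfl | hij
  · rw [if_pos hij.le] at h1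
    rw [if_neg hij.not_ge] at h2
    simp only [Matrix.zero_apply]; linarith
  · rw [if_pos le_rfl] at h1
    simp only [Matrix.zero_apply]; linarith
  · rw [if_pos hij.le] at h2
    rw [if_neg hij.not_ge] at h1
    simp only [Matrix.zero_apply]; linarith

/-- Entrywise scaling by `w`. -/
def hadamardLin {d : ℕ} (w : Matrix (Fin d) (Fin d) ℝ) :
    Matrix (Fin d) (Fin d) ℝ →ₗ[ℝ] Matrix (Fin d) (Fin d) ℝ where
  toFun M := Matrix.of fun i j => w i j * M i j
  map_add' _ _ := by ext; simp [mul_add]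
  map_smul' _ _ := by ext; simp; ring

lemma det_hadamardLin {d : ℕ} (w : Matrix (Fin d) (Fin d) ℝ) :
    LinearMap.det (hadamardLin w) = ∏ i, ∏ j, w i j := by
  rw [det_eq_of_vec_eq_mulVec _ (Matrix.diagonal w.vec), Matrix.det_diagonal,
    Fintype.prod_prod_type, Finset.prod_comm]
  · rfl
  · intro M
    ext ⟨i, j⟩
    rw [Matrix.mulVec_diagonal]
    rfl

/-- Squaring symmetrizes the triangular product: `w i j * w j i` is `x i * x j` off the diagonal and
`1` on it, and `(∏ x i)^2` supplies the missing diagonal. -/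
lemma prod_lower_mul_prod {d : ℕ} (x : Fin d → ℝ) (hx : ∀ i, 0 < x i) :
    (∏ i, ∏ j, if i ≤ j then 1 else x i * x j) * ∏ i, x i = (∏ i, x i) ^ d := by
  set w : Fin d → Fin d → ℝ := fun i j => if i ≤ j then 1 else x i * x j with hw
  have hwpos : ∀ i j, 0 < w i j := fun i j => by
    simp only [hw]
    split_ifs
    · exact one_pos
    · exact mul_pos (hx i) (hx j)
  have hp : 0 < ∏ i, x i := Finset.prod_pos fun i _ => hx i
  have hW : 0 < ∏ i, ∏ j, w i j := Finset.prod_pos fun i _ => Finset.prod_pos fun j _ => hwpos i j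
  change (∏ i, ∏ j, w i j) * _ = _
  rw [← sq_eq_sq₀ (by positivity) (by positivity)]
  have h1 : (∏ i, ∏ j, w i j) ^ 2 = ∏ i, ∏ j, w i j * w j i := by
    simp only [Finset.prod_mul_distrib]
    rw [sq]
    congr 1
    exact Finset.prod_comm
  have h2 : (∏ i, x i) ^ 2 = ∏ i, ∏ j, if i = j then x i * x j else 1 := by
    simp [sq, Finset.prod_mul_distrib]
  have h3 : ((∏ i, x i) ^ d) ^ 2 = ∏ i, ∏ j, x i * x j := by
    simp [Finset.prod_mul_distrib, Finset.prod_pow, sq]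
  rw [mul_pow, h1, h2, h3]
  simp only [← Finset.prod_mul_distrib]
  refine Finset.prod_congr rfl fun i _ => Finset.prod_congr rfl fun j _ => ?_
  simp only [hw]
  rcases lt_trichotomy i j with hij | rfl | hij
  · simp [hij.le, hij.not_ge, hij.ne, mul_comm]
  · simp
  · simp [hij.le, hij.not_ge, hij.ne']

lemma det_skewScale_diagonal {d : ℕ} (x : Fin d → ℝ) (hx : ∀ i, 0 < x i) :
    LinearMap.det (skewScale (Matrix.diagonal x)) * ∏ i, x i = (∏ i, x i) ^ d := by
  have h : symmSkewCoord d ∘ₗ skewScale (Matrix.diagonal x) =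
      hadamardLin (Matrix.of fun i j => if i ≤ j then 1 else x i * x j) ∘ₗ symmSkewCoord d := by
    ext1 M
    ext i j
    simp only [LinearMap.comp_apply, symmSkewCoord, hadamardLin, skewScale, LinearMap.coe_mk,
      AddHom.coe_mk, Matrix.of_apply, Matrix.add_apply, Matrix.smul_apply, Matrix.mul_diagonal,
      Matrix.diagonal_mul, Matrix.sub_apply, Matrix.transpose_apply, smul_eq_mul]
    split_ifs <;> ring
  have h2 := congrArg LinearMap.det h
  rw [LinearMap.det_comp, LinearMap.det_comp, mul_comm] at h2
  rw [mul_right_cancel₀ (det_symmSkewCoord_ne_zero d) h2, det_hadamardLin]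
  exact prod_lower_mul_prod x hx

lemma Matrix.IsHermitian.exists_orthogonal_diagonalization {d : ℕ}
    {P : Matrix (Fin d) (Fin d) ℝ} (hP : P.IsHermitian) :
    ∃ V : Matrix (Fin d) (Fin d) ℝ, Vᵀ * V = 1 ∧ V * Vᵀ = 1 ∧
      P = V * Matrix.diagonal hP.eigenvalues * Vᵀ := by
  refine ⟨hP.eigenvectorUnitary, ?_, ?_, ?_⟩
  · rw [← Matrix.conjTranspose_eq_transpose_of_trivial, ← Matrix.star_eq_conjTranspose]
    exact Unitary.coe_star_mul_self hP.eigenvectorUnitary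
  · rw [← Matrix.conjTranspose_eq_transpose_of_trivial, ← Matrix.star_eq_conjTranspose]
    exact Unitary.coe_mul_star_self hP.eigenvectorUnitary
  · rw [← Matrix.conjTranspose_eq_transpose_of_trivial, ← Matrix.star_eq_conjTranspose]
    simpa [Unitary.conjStarAlgAut_apply] using hP.spectral_theorem

/-- Conjugation by an orthogonal matrix commutes with transposition, so it reduces `P` to its
diagonal of eigenvalues. -/
lemma det_skewScale {d : ℕ} {P : Matrix (Fin d) (Fin d) ℝ} (hP : P.PosDef) :
    LinearMap.det (skewScale P) * P.det = P.det ^ d := by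
  obtain ⟨V, hV, -, hspec⟩ := hP.1.exists_orthogonal_diagonalization
  set x := hP.1.eigenvalues
  have hdetP : P.det = ∏ i, x i := by simpa using hP.1.det_eq_prod_eigenvalues
  have hdV : V.det * V.det = 1 := by
    simpa using congrArg Matrix.det hV
  have hcomm : skewScale P ∘ₗ (mulLeftLin V ∘ₗ mulRightLin Vᵀ) =
      (mulLeftLin V ∘ₗ mulRightLin Vᵀ) ∘ₗ skewScale (Matrix.diagonal x) := by
    ext1 M
    have e1 : (V * (M * Vᵀ))ᵀ = V * (Mᵀ * Vᵀ) := by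
      simp [Matrix.transpose_mul, Matrix.mul_assoc]
    have e2 : P * (V * ((M - Mᵀ) * Vᵀ)) * P =
        V * ((Matrix.diagonal x * (M - Mᵀ) * Matrix.diagonal x) * Vᵀ) := by
      calc P * (V * ((M - Mᵀ) * Vᵀ)) * P
          = V * Matrix.diagonal x * (Vᵀ * V) * (M - Mᵀ) * (Vᵀ * V) * Matrix.diagonal x * Vᵀ := by
            conv_lhs => rw [hspec]
            simp only [Matrix.mul_assoc]
        _ = _ := by simp only [hV, Matrix.mul_one, Matrix.mul_assoc]
    simp only [LinearMap.comp_apply, mulLeftLin_apply, mulRightLin_apply, skewScale_apply, e1]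
    rw [← Matrix.mul_sub, ← Matrix.sub_mul, e2, ← Matrix.mul_add, ← Matrix.add_mul]
    simp only [Matrix.add_mul, Matrix.mul_add, Matrix.smul_mul, Matrix.mul_smul]
  have hc : LinearMap.det (mulLeftLin (d := d) V ∘ₗ mulRightLin Vᵀ) ≠ 0 := by
    rw [LinearMap.det_comp, det_mulLeftLin, det_mulRightLin, Matrix.det_transpose, ← mul_pow, hdV]
    simp
  have h2 := congrArg LinearMap.det hcomm
  rw [LinearMap.det_comp, LinearMap.det_comp (mulLeftLin V ∘ₗ mulRightLin Vᵀ), mul_comm] at h2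
  rw [mul_left_cancel₀ hc h2, hdetP]
  exact det_skewScale_diagonal x hP.eigenvalues_pos

/-! ### The Lyapunov equation -/

/-- The Lyapunov map `T ↦ P T + T P`. -/
def lyapunov {d : ℕ} (P : Matrix (Fin d) (Fin d) ℝ) :
    Matrix (Fin d) (Fin d) ℝ →ₗ[ℝ] Matrix (Fin d) (Fin d) ℝ :=
  mulLeftLin P + mulRightLin P

@[simp] lemma lyapunov_apply {d : ℕ} (P T : Matrix (Fin d) (Fin d) ℝ) :
    lyapunov P T = P * T + T * P := rfl

/-- If `P T + T P = 0`, multiplying by `Tᵀ` and taking traces makes two nonnegative traces sum to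
zero. So `Tᵀ P T = 0`, and definiteness of `P` kills every column of `T`. -/
lemma lyapunov_injective {d : ℕ} {P : Matrix (Fin d) (Fin d) ℝ} (hP : P.PosDef) :
    Function.Injective (lyapunov P) := by
  rw [← LinearMap.ker_eq_bot]
  refine LinearMap.ker_eq_bot'.2 fun T hT => ?_
  rw [lyapunov_apply] at hT
  have h1 : (Tᵀ * P * T).PosSemidef := by
    simpa using hP.posSemidef.conjTranspose_mul_mul_same T
  have h2 : (T * P * Tᵀ).PosSemidef := by
    simpa using hP.posSemidef.mul_mul_conjTranspose_same T
  have h3 : (Tᵀ * P * T).trace + (T * P * Tᵀ).trace = 0 := by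
    rw [Matrix.trace_mul_comm (T * P), Matrix.mul_assoc, ← Matrix.trace_add, ← Matrix.mul_add, hT]
    simp
  have h4 : (Tᵀ * P * T).trace = 0 := by
    have := h1.trace_nonneg
    have := h2.trace_nonneg
    linarith
  rw [h1.trace_eq_zero_iff] at h4
  ext i j
  by_contra hne
  have hv : T.col j ≠ 0 := fun h => hne (by simpa using congrFun h i)
  have hpos := hP.dotProduct_mulVec_pos hv
  have : star (T.col j) ⬝ᵥ (P *ᵥ T.col j) = (Tᵀ * P * T) j j := by
    rw [Matrix.mul_assoc]
    rfl
  rw [this, h4] at hpos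
  simp at hpos

/-- The Lyapunov map of a positive definite matrix as a linear equivalence. -/
def lyapunovEquiv {d : ℕ} {P : Matrix (Fin d) (Fin d) ℝ} (hP : P.PosDef) :
    Matrix (Fin d) (Fin d) ℝ ≃ₗ[ℝ] Matrix (Fin d) (Fin d) ℝ :=
  LinearEquiv.ofInjectiveEndo (lyapunov P) (lyapunov_injective hP)

@[simp] lemma lyapunovEquiv_apply {d : ℕ} {P : Matrix (Fin d) (Fin d) ℝ} (hP : P.PosDef)
    (T : Matrix (Fin d) (Fin d) ℝ) : lyapunovEquiv hP T = P * T + T * P := rfl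

lemma lyapunovEquiv_symm_spec {d : ℕ} {P : Matrix (Fin d) (Fin d) ℝ} (hP : P.PosDef)
    (S : Matrix (Fin d) (Fin d) ℝ) :
    P * (lyapunovEquiv hP).symm S + (lyapunovEquiv hP).symm S * P = S :=
  (lyapunovEquiv hP).apply_symm_apply S

lemma lyapunovEquiv_symm_transpose {d : ℕ} {P : Matrix (Fin d) (Fin d) ℝ} (hP : P.PosDef)
    {S : Matrix (Fin d) (Fin d) ℝ} (hS : Sᵀ = S) :
    ((lyapunovEquiv hP).symm S)ᵀ = (lyapunovEquiv hP).symm S := by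
  have hPt : Pᵀ = P := by simpa using hP.1.eq
  apply (lyapunovEquiv hP).injective
  rw [LinearEquiv.apply_symm_apply, lyapunovEquiv_apply]
  have h := congrArg Matrix.transpose (lyapunovEquiv_symm_spec hP S)
  rw [Matrix.transpose_add, Matrix.transpose_mul, Matrix.transpose_mul, hPt, hS] at h
  rw [add_comm, h]

/-! ### Determinant of the polar tangent map -/

/-- The correction `M ↦ T - ½ (M + Mᵀ) P`, where `P T + T P = M + Mᵀ`. -/
def polarCorrection {d : ℕ} {P : Matrix (Fin d) (Fin d) ℝ} (hP : P.PosDef) :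
    Matrix (Fin d) (Fin d) ℝ →ₗ[ℝ] Matrix (Fin d) (Fin d) ℝ :=
  ((lyapunovEquiv hP).symm : Matrix (Fin d) (Fin d) ℝ →ₗ[ℝ] Matrix (Fin d) (Fin d) ℝ) ∘ₗ symmLin d
    - (1 / 2 : ℝ) • (mulRightLin P ∘ₗ symmLin d)

lemma polarCorrection_apply {d : ℕ} {P : Matrix (Fin d) (Fin d) ℝ} (hP : P.PosDef)
    (M : Matrix (Fin d) (Fin d) ℝ) :
    polarCorrection hP M =
      (lyapunovEquiv hP).symm (M + Mᵀ) - (1 / 2 : ℝ) • ((M + Mᵀ) * P) := rfl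

/-- This is the square case `H = 1`. After left multiplication by `P`, the map is `skewScale P`
followed by the unipotent shear `id + ν`, where `ν` sends the symmetric part to a skew matrix. -/
lemma det_mulRightLin_add_polarCorrection {d : ℕ} {P : Matrix (Fin d) (Fin d) ℝ}
    (hP : P.PosDef) :
    LinearMap.det (mulRightLin P + polarCorrection hP) * P.det = 1 := by
  set T := (lyapunovEquiv hP).symm
  have hPt : Pᵀ = P := by simpa using hP.1.eq
  let ν : Matrix (Fin d) (Fin d) ℝ →ₗ[ℝ] Matrix (Fin d) (Fin d) ℝ :=
    (1 / 2 : ℝ) • ((mulLeftLin P - mulRightLin P) ∘ₗ (T : _ →ₗ[ℝ] _) ∘ₗ symmLin d)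
  have hν : ∀ M, ν M = (1 / 2 : ℝ) • (P * T (M + Mᵀ) - T (M + Mᵀ) * P) := fun M => rfl
  -- `ν` sees only the symmetric part of its argument, and its values have none.
  have hdetν : LinearMap.det (LinearMap.id + ν) = 1 := by
    have e1 : ν = ν ∘ₗ ((1 / 2 : ℝ) • symmLin d) := by
      ext1 M
      rw [LinearMap.comp_apply, hν, hν]
      have : ((1 / 2 : ℝ) • symmLin d) M + (((1 / 2 : ℝ) • symmLin d) M)ᵀ = M + Mᵀ := by
        simp only [LinearMap.smul_apply, symmLin_apply, Matrix.transpose_smul,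
          Matrix.transpose_add, Matrix.transpose_transpose]
        module
      rw [this]
    have e2 : ((1 / 2 : ℝ) • symmLin d) ∘ₗ ν = 0 := by
      ext1 M
      have hs : (T (M + Mᵀ))ᵀ = T (M + Mᵀ) :=
        lyapunovEquiv_symm_transpose hP (by simp [add_comm])
      rw [LinearMap.comp_apply, hν]
      simp only [LinearMap.smul_apply, symmLin_apply, Matrix.transpose_smul,
          Matrix.transpose_sub, Matrix.transpose_mul, hs, hPt, LinearMap.zero_apply]
      module
    rw [e1, LinearMap.det_id_add_comp_comm, e2, add_zero, LinearMap.det_id]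
  have hfac : mulLeftLin P ∘ₗ (mulRightLin P + polarCorrection hP) =
      (LinearMap.id + ν) ∘ₗ skewScale P := by
    ext1 M
    have hsk : skewScale P M + (skewScale P M)ᵀ = M + Mᵀ := by
      simp only [skewScale_apply, Matrix.transpose_add, Matrix.transpose_smul,
        Matrix.transpose_mul, Matrix.transpose_sub, Matrix.transpose_transpose, hPt,
        Matrix.mul_sub, Matrix.sub_mul, Matrix.mul_assoc]
      module
    have hT : T (M + Mᵀ) * P = M + Mᵀ - P * T (M + Mᵀ) :=
      eq_sub_of_add_eq' (lyapunovEquiv_symm_spec hP (M + Mᵀ))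
    simp only [LinearMap.comp_apply, LinearMap.add_apply, LinearMap.id_apply, hν, hsk, hT,
      mulLeftLin_apply, mulRightLin_apply, polarCorrection_apply]
    rw [skewScale_apply]
    simp only [Matrix.mul_add, Matrix.mul_sub, Matrix.sub_mul, Matrix.add_mul, Matrix.mul_smul,
      Matrix.mul_assoc]
    module
  have h := congrArg LinearMap.det hfac
  rw [LinearMap.det_comp, LinearMap.det_comp, hdetν, one_mul, det_mulLeftLin] at h
  have h2 := det_skewScale hP
  rw [← h, mul_assoc] at h2
  exact mul_left_cancel₀ (pow_ne_zero d hP.det_pos.ne') (h2.trans (mul_one _).symm)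

/-- The tangent map of the polar parametrization `(H, S) ↦ H P`. -/
def polarTangent {n d : ℕ} {P : Matrix (Fin d) (Fin d) ℝ} (hP : P.PosDef)
    (H : Matrix (Fin n) (Fin d) ℝ) :
    Matrix (Fin n) (Fin d) ℝ →ₗ[ℝ] Matrix (Fin n) (Fin d) ℝ :=
  mulRightLin P + mulLeftLin H ∘ₗ polarCorrection hP ∘ₗ mulLeftLin Hᵀ

lemma polarTangent_apply {n d : ℕ} {P : Matrix (Fin d) (Fin d) ℝ} (hP : P.PosDef)
    (H K : Matrix (Fin n) (Fin d) ℝ) :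
    polarTangent hP H K = K * P + H * polarCorrection hP (Hᵀ * K) := rfl

/-- The correction factors through `d × d` matrices, so Weinstein–Aronszajn and `Hᵀ H = 1` reduce to
the square case. The powers stay on both sides because `n - d - 1` can be negative. -/
lemma det_polarTangent {n d : ℕ} {P : Matrix (Fin d) (Fin d) ℝ} (hP : P.PosDef)
    {H : Matrix (Fin n) (Fin d) ℝ} (hH : Hᵀ * H = 1) :
    LinearMap.det (polarTangent hP H) * P.det ^ (d + 1) = P.det ^ n := by
  have hu : IsUnit P.det := hP.det_pos.ne'.isUnit
  let σ := polarCorrection hP ∘ₗ mulRightLin P⁻¹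
  have h1 : polarTangent hP H =
      (LinearMap.id + mulLeftLin H ∘ₗ (σ ∘ₗ mulLeftLin Hᵀ)) ∘ₗ mulRightLin P := by
    ext1 K
    simp only [σ, polarTangent, LinearMap.comp_apply, LinearMap.add_apply, LinearMap.id_apply,
      mulLeftLin_apply, mulRightLin_apply, Matrix.mul_assoc, Matrix.mul_nonsing_inv _ hu,
      Matrix.mul_one]
  have h2 : mulRightLin P + polarCorrection hP = (LinearMap.id + σ) ∘ₗ mulRightLin P := by
    ext1 K
    simp only [σ, LinearMap.comp_apply, LinearMap.add_apply, LinearMap.id_apply,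
      mulRightLin_apply, Matrix.mul_assoc, Matrix.mul_nonsing_inv _ hu, Matrix.mul_one]
  have h3 : (σ ∘ₗ mulLeftLin (d := d) Hᵀ) ∘ₗ mulLeftLin H = σ := by
    ext1 K
    simp only [LinearMap.comp_apply, mulLeftLin_apply, ← Matrix.mul_assoc, hH, Matrix.one_mul]
  have h4 := det_mulRightLin_add_polarCorrection hP
  rw [h2, LinearMap.det_comp, det_mulRightLin] at h4
  rw [h1, LinearMap.det_comp, det_mulRightLin, LinearMap.det_id_add_comp_comm, h3]
  linear_combination P.det ^ n * h4

/-! ### Monotonicity of the determinant; square roots -/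

lemma det_one_add_ge_one {d : ℕ} {E : Matrix (Fin d) (Fin d) ℝ} (hE : E.PosSemidef) :
    1 ≤ (1 + E).det := by
  obtain ⟨V, -, hV, hspec⟩ := hE.1.exists_orthogonal_diagonalization
  set x := hE.1.eigenvalues
  have hdV : V.det * V.det = 1 := by
    simpa using congrArg Matrix.det hV
  have h : 1 + E = V * Matrix.diagonal (fun i => 1 + x i) * Vᵀ := by
    rw [← Matrix.diagonal_add, Matrix.diagonal_one, Matrix.mul_add, Matrix.add_mul, ← hspec,
      Matrix.mul_one, hV]
  rw [h, Matrix.det_mul, Matrix.det_mul, Matrix.det_transpose, Matrix.det_diagonal,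
    mul_right_comm, hdV, one_mul]
  calc (1 : ℝ) = ∏ _i : Fin d, (1 : ℝ) := by simp
    _ ≤ ∏ i, (1 + x i) := Finset.prod_le_prod (fun _ _ => zero_le_one)
        fun i _ => le_add_of_nonneg_right (hE.eigenvalues_nonneg i)

section SquareRoot

open scoped MatrixOrder

variable {d : ℕ} {A R : Matrix (Fin d) (Fin d) ℝ}

lemma psdSqrt_posSemidef (A : Matrix (Fin d) (Fin d) ℝ) : (psdSqrt A).PosSemidef :=
  Matrix.nonneg_iff_posSemidef.1 (CFC.sqrt_nonneg A)

lemma psdSqrt_mul_self (hA : A.PosSemidef) : psdSqrt A * psdSqrt A = A :=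
  CFC.sqrt_mul_sqrt_self A (Matrix.nonneg_iff_posSemidef.2 hA)

lemma psdSqrt_eq (hR : R.PosSemidef) (h : R * R = A) : psdSqrt A = R :=
  CFC.sqrt_unique h (Matrix.nonneg_iff_posSemidef.2 hR)

lemma psdSqrt_posDef (hA : A.PosDef) : (psdSqrt A).PosDef := by
  rw [(psdSqrt_posSemidef A).posDef_iff_det_ne_zero]
  intro h
  have := congrArg Matrix.det (psdSqrt_mul_self hA.posSemidef)
  rw [Matrix.det_mul, h, mul_zero] at this
  exact hA.det_pos.ne this

lemma Matrix.PosSemidef.transpose_eq (hA : A.PosSemidef) : Aᵀ = A := by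
  simpa using hA.1.eq

lemma det_le_det_add {B : Matrix (Fin d) (Fin d) ℝ} (hA : A.PosDef) (hB : B.PosSemidef) :
    A.det ≤ (A + B).det := by
  set C := psdSqrt A
  have hC : C.PosDef := psdSqrt_posDef hA
  have hu : IsUnit C.det := hC.det_pos.ne'.isUnit
  have hE : (C⁻¹ * B * C⁻¹).PosSemidef := by
    have := hB.conjTranspose_mul_mul_same C⁻¹
    rwa [hC.inv.1.eq] at this
  have h : A + B = C * (1 + C⁻¹ * B * C⁻¹) * C := by
    rw [Matrix.mul_add, Matrix.add_mul, Matrix.mul_one, psdSqrt_mul_self hA.posSemidef]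
    congr 1
    simp only [← Matrix.mul_assoc, Matrix.mul_nonsing_inv _ hu, Matrix.one_mul]
    rw [Matrix.mul_assoc, Matrix.nonsing_inv_mul _ hu, Matrix.mul_one]
  have hdet : A.det = C.det * C.det := by
    rw [← Matrix.det_mul, psdSqrt_mul_self hA.posSemidef]
  rw [h, Matrix.det_mul, Matrix.det_mul, hdet]
  nlinarith [det_one_add_ge_one hE, mul_pos hC.det_pos hC.det_pos]

end SquareRoot

/-! ### Differentiability of square root and inverse -/

section Calculus

open scoped Matrix.Norms.L2Operator Topology
open Filter

/-- Matrix multiplication as a continuous bilinear map. -/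
def matMulCLM (l m n : ℕ) : Matrix (Fin l) (Fin m) ℝ →L[ℝ] Matrix (Fin m) (Fin n) ℝ →L[ℝ]
    Matrix (Fin l) (Fin n) ℝ :=
  LinearMap.toContinuousBilinearMap <|
    LinearMap.mk₂ ℝ (fun A B => A * B) Matrix.add_mul (fun _ _ _ => Matrix.smul_mul _ _ _)
      Matrix.mul_add (fun _ _ _ => Matrix.mul_smul _ _ _)

variable {E : Type*} [NormedAddCommGroup E] [NormedSpace ℝ E]

lemma HasFDerivAt.matrix_mul {l m n : ℕ} {f : E → Matrix (Fin l) (Fin m) ℝ}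
    {g : E → Matrix (Fin m) (Fin n) ℝ} {f' : E →L[ℝ] Matrix (Fin l) (Fin m) ℝ}
    {g' : E →L[ℝ] Matrix (Fin m) (Fin n) ℝ} {x : E}
    (hf : HasFDerivAt f f' x) (hg : HasFDerivAt g g' x) :
    HasFDerivAt (fun y => f y * g y)
      ((matMulCLM l m n).precompR E (f x) g' + (matMulCLM l m n).precompL E f' (g x)) x :=
  (matMulCLM l m n).hasFDerivAt_of_bilinear hf hg

variable {d : ℕ} {P : Matrix (Fin d) (Fin d) ℝ}

lemma hasStrictFDerivAt_mul_self (hP : P.PosDef) :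
    HasStrictFDerivAt (fun A : Matrix (Fin d) (Fin d) ℝ => A * A)
      ((lyapunovEquiv hP).toContinuousLinearEquiv :
        Matrix (Fin d) (Fin d) ℝ →L[ℝ] Matrix (Fin d) (Fin d) ℝ) P := by
  have h := (hasStrictFDerivAt_id (𝕜 := ℝ) P).mul' (hasStrictFDerivAt_id (𝕜 := ℝ) P)
  refine h.congr_fderiv ?_
  ext1 T
  simp

/-- The inverse function theorem applies to `A ↦ A * A`, whose derivative at `P` is the Lyapunov
map. For symmetric `N`, the transpose of the local root is another root near `P`, so local
uniqueness makes the root symmetric. -/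
lemma exists_symmetric_local_sqrt (hP : P.PosDef) :
    ∃ g : Matrix (Fin d) (Fin d) ℝ → Matrix (Fin d) (Fin d) ℝ,
      HasFDerivAt g ((lyapunovEquiv hP).symm.toContinuousLinearEquiv :
        Matrix (Fin d) (Fin d) ℝ →L[ℝ] Matrix (Fin d) (Fin d) ℝ) (P * P) ∧
      Tendsto g (𝓝 (P * P)) (𝓝 P) ∧
      ∀ᶠ N in 𝓝 (P * P), Nᵀ = N → (g N)ᵀ = g N ∧ g N * g N = N := by
  have hs := hasStrictFDerivAt_mul_self hP
  have hPt : Pᵀ = P := hP.posSemidef.transpose_eq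
  have ht := hs.localInverse_tendsto
  have htt : Tendsto (fun N => (hs.localInverse _ _ _ N)ᵀ) (𝓝 (P * P)) (𝓝 P) := by
    have := ((continuous_id.matrix_transpose).tendsto P).comp ht
    rwa [id, hPt] at this
  refine ⟨hs.localInverse _ _ _, hs.to_localInverse.hasFDerivAt, ht, ?_⟩
  filter_upwards [hs.eventually_right_inverse, htt.eventually hs.eventually_left_inverse]
    with N h1 h2 hN
  refine ⟨?_, h1⟩
  rw [← h2, ← Matrix.transpose_mul, h1, hN]

/-- Such an `N` is the square of a symmetric matrix. -/
lemma eventually_posSemidef_of_symmetric (hP : P.PosDef) :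
    ∀ᶠ N in 𝓝 P, Nᵀ = N → N.PosSemidef := by
  obtain ⟨g, -, -, hg⟩ := exists_symmetric_local_sqrt (psdSqrt_posDef hP)
  rw [psdSqrt_mul_self hP.posSemidef] at hg
  filter_upwards [hg] with N h hN
  obtain ⟨h1, h2⟩ := h hN
  rw [← h2]
  nth_rw 1 [← h1]
  simpa using Matrix.posSemidef_conjTranspose_mul_self (g N)

/-- The local root agrees with `psdSqrt` only at symmetric matrices, hence the composition with a
symmetric-valued `f`. -/
lemma HasFDerivAt.psdSqrt {f : E → Matrix (Fin d) (Fin d) ℝ}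
    {f' : E →L[ℝ] Matrix (Fin d) (Fin d) ℝ} {x : E} (hf : HasFDerivAt f f' x)
    (hsymm : ∀ y, (f y)ᵀ = f y) (hP : P.PosDef) (hx : P * P = f x) :
    HasFDerivAt (fun y => psdSqrt (f y))
      (((lyapunovEquiv hP).symm.toContinuousLinearEquiv :
        Matrix (Fin d) (Fin d) ℝ →L[ℝ] Matrix (Fin d) (Fin d) ℝ) ∘L f') x := by
  obtain ⟨g, hg, hgt, hgs⟩ := exists_symmetric_local_sqrt hP
  rw [hx] at hg hgt hgs
  have hc := hf.continuousAt.tendsto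
  refine (hg.comp x hf).congr_of_eventuallyEq ?_
  filter_upwards [hc.eventually hgs,
    (hgt.comp hc).eventually (eventually_posSemidef_of_symmetric hP)] with y h1 h2
  obtain ⟨h3, h4⟩ := h1 (hsymm y)
  exact psdSqrt_eq (h2 h3) h4

lemma HasFDerivAt.matrix_inv {f : E → Matrix (Fin d) (Fin d) ℝ}
    {f' : E →L[ℝ] Matrix (Fin d) (Fin d) ℝ} {x : E} (hf : HasFDerivAt f f' x)
    (hx : IsUnit (f x)) :
    HasFDerivAt (fun y => (f y)⁻¹)
      (-(ContinuousLinearMap.mulLeftRight ℝ _ (f x)⁻¹ (f x)⁻¹) ∘L f') x := by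
  obtain ⟨u, hu⟩ := hx
  have h := hasFDerivAt_ringInverse (𝕜 := ℝ) u
  have hinv : ((u⁻¹ : (Matrix (Fin d) (Fin d) ℝ)ˣ) : Matrix (Fin d) (Fin d) ℝ) = (f x)⁻¹ := by
    rw [← hu, Matrix.coe_units_inv]
  rw [hu, hinv] at h
  simp only [Matrix.nonsing_inv_eq_ringInverse] at h ⊢
  exact h.comp x hf

end Calculus

/-! ### The derivative of the aligned matrix -/

section Derivative

open scoped Matrix.Norms.L2Operator

variable {n d : ℕ} {P Q B : Matrix (Fin d) (Fin d) ℝ} {X : Matrix (Fin n) (Fin d) ℝ}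

/-- The derivative of `Y ↦ Yᵀ Y` at `X`. -/
def gramDeriv (X : Matrix (Fin n) (Fin d) ℝ) :
    Matrix (Fin n) (Fin d) ℝ →ₗ[ℝ] Matrix (Fin d) (Fin d) ℝ :=
  symmLin d ∘ₗ mulLeftLin Xᵀ

lemma gramDeriv_apply (X Z : Matrix (Fin n) (Fin d) ℝ) :
    gramDeriv X Z = Xᵀ * Z + Zᵀ * X := by
  simp [gramDeriv]

/-- The derivative of `alignedMatrix B` at `X`, where `P` and `Q` are the square roots of
`Xᵀ X` and `Xᵀ X - B`. -/
def alignedDeriv (hP : P.PosDef) (hQ : Q.PosDef) (X : Matrix (Fin n) (Fin d) ℝ) :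
    Matrix (Fin n) (Fin d) ℝ →ₗ[ℝ] Matrix (Fin n) (Fin d) ℝ :=
  mulRightLin Q ∘ₗ mulRightLin P⁻¹ ∘ₗ (LinearMap.id -
    mulLeftLin (X * P⁻¹) ∘ₗ ((lyapunovEquiv hP).symm : _ →ₗ[ℝ] _) ∘ₗ gramDeriv X) +
  mulLeftLin (X * P⁻¹) ∘ₗ ((lyapunovEquiv hQ).symm : _ →ₗ[ℝ] _) ∘ₗ gramDeriv X

lemma alignedDeriv_apply (hP : P.PosDef) (hQ : Q.PosDef) (X Z : Matrix (Fin n) (Fin d) ℝ) :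
    alignedDeriv hP hQ X Z =
      (Z - X * P⁻¹ * (lyapunovEquiv hP).symm (gramDeriv X Z)) * P⁻¹ * Q +
        X * P⁻¹ * (lyapunovEquiv hQ).symm (gramDeriv X Z) := rfl

lemma hasFDerivAt_vectorized_alignedMatrix (hP : P.PosDef) (hQ : Q.PosDef)
    (hPX : P * P = Xᵀ * X) (hQX : Q * Q = Xᵀ * X - B) (hB : Bᵀ = B) :
    HasFDerivAt (vectorized (alignedMatrix B))
      (LinearMap.toContinuousLinearMap ((vecEquiv n d : _ →ₗ[ℝ] _) ∘ₗ alignedDeriv hP hQ X ∘ₗ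
        ((vecEquiv n d).symm : _ →ₗ[ℝ] _))) X.vec := by
  have hY : HasFDerivAt (fun v : Fin d × Fin n → ℝ => (unvec v : Matrix (Fin n) (Fin d) ℝ))
      ((vecEquiv n d).symm.toContinuousLinearEquiv :
        (Fin d × Fin n → ℝ) →L[ℝ] Matrix (Fin n) (Fin d) ℝ) X.vec :=
    (vecEquiv n d).symm.toContinuousLinearEquiv.hasFDerivAt
  let tr : Matrix (Fin n) (Fin d) ℝ →L[ℝ] Matrix (Fin d) (Fin n) ℝ :=
    LinearMap.toContinuousLinearMap (Matrix.transposeLinearEquiv (Fin n) (Fin d) ℝ ℝ).toLinearMap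
  have hYt := tr.hasFDerivAt.comp X.vec hY
  have hS := hYt.matrix_mul hY
  have hP' := hS.psdSqrt (P := P) (fun v => Matrix.transpose_mul _ _) hP hPX
  have hQ' := (hS.sub_const B).psdSqrt (P := Q)
    (fun v => by
      rw [Matrix.transpose_sub, hB]
      exact congrArg (· - B) (Matrix.transpose_mul _ _)) hQ hQX
  have hsP : psdSqrt (Xᵀ * X) = P := psdSqrt_eq hP.posSemidef hPX
  have hsQ : psdSqrt (Xᵀ * X - B) = Q := psdSqrt_eq hQ.posSemidef hQX
  have hPi := hP'.matrix_inv (by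
    change IsUnit (psdSqrt (Xᵀ * X))
    rw [hsP]
    exact hP.isUnit)
  have hU := (hY.matrix_mul hPi).matrix_mul hQ'
  have hV := ((vecEquiv n d).toContinuousLinearEquiv :
    Matrix (Fin n) (Fin d) ℝ →L[ℝ] (Fin d × Fin n → ℝ)).hasFDerivAt.comp X.vec hU
  refine hV.congr_fderiv ?_
  ext1 v
  -- The left side is the product-rule derivative, unfolded at `v`.
  change ((X * (psdSqrt (Xᵀ * X))⁻¹) * (lyapunovEquiv hQ).symm
      (Xᵀ * unvec v + (unvec v)ᵀ * X) +
    (X * -((psdSqrt (Xᵀ * X))⁻¹ * (lyapunovEquiv hP).symm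
      (Xᵀ * unvec v + (unvec v)ᵀ * X) * (psdSqrt (Xᵀ * X))⁻¹) +
      unvec v * (psdSqrt (Xᵀ * X))⁻¹) * psdSqrt (Xᵀ * X - B)).vec =
    (alignedDeriv hP hQ X (unvec v)).vec
  rw [hsP, hsQ, alignedDeriv_apply, gramDeriv_apply]
  congr 1
  simp only [Matrix.add_mul, Matrix.sub_mul, Matrix.mul_neg, Matrix.neg_mul, Matrix.mul_assoc]
  abel

end Derivative

/-! ### The chain rule in polar coordinates -/

variable {n d : ℕ} {P Q : Matrix (Fin d) (Fin d) ℝ} {X : Matrix (Fin n) (Fin d) ℝ}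

/-- The result does not involve `P`: this is why the same `K` describes the motion of both `H P` and
`H Q`. -/
lemma gramDeriv_polarTangent (hP : P.PosDef) {H : Matrix (Fin n) (Fin d) ℝ} (hH : Hᵀ * H = 1)
    (K : Matrix (Fin n) (Fin d) ℝ) :
    gramDeriv (H * P) (polarTangent hP H K) = Hᵀ * K + (Hᵀ * K)ᵀ := by
  have hPt : Pᵀ = P := hP.posSemidef.transpose_eq
  set M := Hᵀ * K with hM
  have hT := lyapunovEquiv_symm_spec hP (M + Mᵀ)
  have hTt := lyapunovEquiv_symm_transpose hP (S := M + Mᵀ) (by simp [add_comm])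
  have h1 : Hᵀ * polarTangent hP H K =
      (1 / 2 : ℝ) • ((M - Mᵀ) * P) + (lyapunovEquiv hP).symm (M + Mᵀ) := by
    rw [polarTangent_apply, Matrix.mul_add, ← Matrix.mul_assoc, ← Matrix.mul_assoc, hH,
      Matrix.one_mul, ← hM, polarCorrection_apply]
    simp only [Matrix.add_mul, Matrix.sub_mul]
    module
  have h2 : (H * P)ᵀ * polarTangent hP H K =
      P * ((1 / 2 : ℝ) • ((M - Mᵀ) * P) + (lyapunovEquiv hP).symm (M + Mᵀ)) := by
    rw [Matrix.transpose_mul, hPt, Matrix.mul_assoc, h1]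
  have h3 : gramDeriv (H * P) (polarTangent hP H K) =
      (H * P)ᵀ * polarTangent hP H K + ((H * P)ᵀ * polarTangent hP H K)ᵀ := rfl
  rw [h3, h2]
  clear_value M
  rw [Matrix.transpose_mul, Matrix.transpose_add, hTt, hPt]
  refine Eq.trans ?_ hT
  simp only [Matrix.transpose_smul, Matrix.transpose_mul, Matrix.transpose_sub,
    Matrix.transpose_transpose, hPt, Matrix.mul_add, Matrix.add_mul, Matrix.mul_sub,
    Matrix.sub_mul, Matrix.mul_smul, Matrix.smul_mul, Matrix.mul_assoc]
  module

lemma alignedDeriv_comp_polarTangent (hP : P.PosDef) (hQ : Q.PosDef)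
    {H : Matrix (Fin n) (Fin d) ℝ} (hH : Hᵀ * H = 1) :
    alignedDeriv hP hQ (H * P) ∘ₗ polarTangent hP H = polarTangent hQ H := by
  have hu : IsUnit P.det := hP.det_pos.ne'.isUnit
  ext1 K
  have hHP : H * P * P⁻¹ = H := by
    rw [Matrix.mul_assoc, Matrix.mul_nonsing_inv _ hu, Matrix.mul_one]
  rw [LinearMap.comp_apply, alignedDeriv_apply, gramDeriv_polarTangent hP hH, hHP]
  set M := Hᵀ * K with hM
  have h1 : polarTangent hP H K - H * (lyapunovEquiv hP).symm (M + Mᵀ) =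
      (K - (1 / 2 : ℝ) • (H * (M + Mᵀ))) * P := by
    rw [polarTangent_apply, ← hM, polarCorrection_apply]
    simp only [Matrix.mul_sub, Matrix.sub_mul, Matrix.mul_smul, Matrix.smul_mul, Matrix.mul_assoc]
    abel
  rw [h1, Matrix.mul_assoc _ P, Matrix.mul_nonsing_inv _ hu, Matrix.mul_one, polarTangent_apply,
    ← hM, polarCorrection_apply]
  simp only [Matrix.mul_sub, Matrix.sub_mul, Matrix.mul_smul, Matrix.smul_mul, Matrix.mul_assoc]
  abel

lemma det_alignedDeriv (hP : P.PosDef) (hQ : Q.PosDef) (hPX : P * P = Xᵀ * X) :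
    LinearMap.det (alignedDeriv hP hQ X) * (P.det ^ n * Q.det ^ (d + 1)) =
      Q.det ^ n * P.det ^ (d + 1) := by
  have hu : IsUnit P.det := hP.det_pos.ne'.isUnit
  have hPt : Pᵀ = P := hP.posSemidef.transpose_eq
  obtain ⟨H, hH, rfl⟩ : ∃ H : Matrix (Fin n) (Fin d) ℝ, Hᵀ * H = 1 ∧ X = H * P := by
    refine ⟨X * P⁻¹, ?_, ?_⟩
    · rw [Matrix.transpose_mul, Matrix.transpose_nonsing_inv, hPt, Matrix.mul_assoc,
        ← Matrix.mul_assoc Xᵀ, ← hPX, Matrix.mul_assoc, Matrix.mul_nonsing_inv _ hu,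
        Matrix.mul_one, Matrix.nonsing_inv_mul _ hu]
    · rw [Matrix.mul_assoc, Matrix.nonsing_inv_mul _ hu, Matrix.mul_one]
  have h := congrArg LinearMap.det (alignedDeriv_comp_polarTangent hP hQ hH)
  rw [LinearMap.det_comp] at h
  have hp := det_polarTangent hP hH
  have hq := det_polarTangent hQ hH
  rw [← h] at hq
  rw [← hp, ← hq]
  ring

end

theorem mainTheorem4 (n d : ℕ) (X : Matrix (Fin n) (Fin d) ℝ) (B : Matrix (Fin d) (Fin d) ℝ)
    (hB : B.PosSemidef) (hXB : (Xᵀ * X - B).PosDef) :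
    DifferentiableAt ℝ (vectorized (alignedMatrix B)) X.vec ∧
      (jacobianMatrix (alignedMatrix B) X).det ≠ 0 ∧
      1 / |(jacobianMatrix (alignedMatrix B) X).det| ≤
        ((Xᵀ * X).det / (Xᵀ * X - B).det) ^ ((n : ℝ) / 2) := by
  have hX : (Xᵀ * X).PosDef := by simpa using hXB.add_posSemidef hB
  have hP := psdSqrt_posDef hX
  have hQ := psdSqrt_posDef hXB
  have hPX := psdSqrt_mul_self hX.posSemidef
  have hQX := psdSqrt_mul_self hXB.posSemidef
  have hD := hasFDerivAt_vectorized_alignedMatrix hP hQ hPX hQX hB.transpose_eq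
  have hdet : (jacobianMatrix (alignedMatrix B) X).det =
      LinearMap.det (alignedDeriv hP hQ X) := by
    rw [jacobianMatrix, LinearMap.det_toMatrix', hD.fderiv]
    exact LinearMap.det_conj (alignedDeriv hP hQ X) (vecEquiv n d)
  have key := det_alignedDeriv hP hQ hPX
  have hle : (Xᵀ * X - B).det ≤ (Xᵀ * X).det := by simpa using det_le_det_add hXB hB
  rw [← hdet] at key
  have hp := hP.det_pos
  have hq := hQ.det_pos
  have hdX := congrArg Matrix.det hPX
  have hdXB := congrArg Matrix.det hQX
  rw [Matrix.det_mul] at hdX hdXB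
  rw [← hdX, ← hdXB] at hle ⊢
  set p := (psdSqrt (Xᵀ * X)).det
  set q := (psdSqrt (Xᵀ * X - B)).det
  set δ := (jacobianMatrix (alignedMatrix B) X).det
  have hqp : q ≤ p := by nlinarith
  have hδ : δ = (q ^ n * p ^ (d + 1)) / (p ^ n * q ^ (d + 1)) := by
    rw [eq_div_iff (by positivity), key]
  have hδpos : 0 < δ := by rw [hδ]; positivity
  refine ⟨hD.differentiableAt, hδpos.ne', ?_⟩
  have hpow : (p * p / (q * q)) ^ ((n : ℝ) / 2) = p ^ n / q ^ n := by
    rw [← div_pow, ← Real.rpow_natCast, mul_div_mul_comm, ← sq, ← Real.rpow_natCast (p / q) 2,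
      ← Real.rpow_mul (by positivity)]
    congr 1
    push_cast
    ring
  rw [abs_of_pos hδpos, hpow, hδ, one_div_div, div_le_div_iff₀ (by positivity) (by positivity)]
  -- The bound discards exactly the factor `(p / q)^(d + 1) ≥ 1`.
  have := pow_le_pow_left₀ hq.le hqp (d + 1)
  calc p ^ n * q ^ (d + 1) * q ^ n = (p ^ n * q ^ n) * q ^ (d + 1) := by ring
    _ ≤ (p ^ n * q ^ n) * p ^ (d + 1) := by gcongr
    _ = _ := by ring
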